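/- Let $M$ be a von Neumann algebra with a faithful normal tracial state $\varphi$, and let $X=\{x_1,\dots,x_n\}$ be a finite tuple of selfadjoint elements of $M$ which generates $M$ as a von Neumann algebra, $X''=M$. For $m,k\in\mathbb N$ and $\gamma>0$ let $\Gamma(X;m,k,\gamma)$ be the set of all $n$-tuples $(a_1,\dots,a_n)$ of selfadjoint $k\times k$ complex matrices with $$|tr_k(a_{i_1}\cdots a_{i_p})-\varphi(x_{i_1}\cdots x_{i_p})|<\gamma\qquad\text{for all }1\le p\le m,\ 1\le i_1,\dots,i_p\le n,$$ where $tr_k$ is the normalized trace; for a tuple $\xi$ of selfadjoint matrices put $|\xi|_2=\big(\sum_{i}tr_k(\xi_i^2)\big)^{1/2}$. The tuple $X$ is called tubular if for every $\epsilon>0$ there are $m\in\mathbb N$ and $\gamma>0$ such that for every $k$ and all $\xi,\eta\in\Gamma(X;m,k,\gamma)$ there is a unitary $k\times k$ matrix $u$ with $|u\xi u^*-\eta|_2<\epsilon$, where $u\xi u^*=(u\xi_1u^*,\dots,u\xi_nu^*)$. Let $\mathcal R$ be the hyperfinite $\mathrm{II}_1$-factor with trace $\tau$, that is, an infinite dimensional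 factor with a faithful normal tracial state $\tau$ which is generated as a von Neumann algebra by an increasing sequence of full matrix algebras containing its unit. Let $\omega$ be a nonprincipal ultrafilter on $\mathbb N$, and let $\mathcal R^\omega=\ell^\infty(\mathcal R)/\{(a_j)_j:\lim_{j\to\omega}\tau(a_j^*a_j)=0\}$ be the tracial ultrapower, with the trace induced by $(a_j)_j\mapsto\lim_{j\to\omega}\tau(a_j)$. An embedding of $M$ into $\mathcal R^\omega$ is a normal, injective, unital, trace preserving $*$-homomorphism $M\to\mathcal R^\omega$. If $X$ is tubular, then any two embeddings $\sigma,\pi$ of $X''=M$ into $\mathcal R^\omega$ are conjugate by a unitary in $\mathcal R^\omega$: there is a unitary $u\in\mathcal R^\omega$ with $\sigma(a)=u\,\pi(a)\,u^*$ for all $a\in M$. -/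

import Mathlib

open scoped ComplexOrder InnerProductSpace

noncomputable section

namespace Tubular

universe u v

section Trace

variable {H : Type u} [NormedAddCommGroup H] [InnerProductSpace ℂ H] [CompleteSpace H]

/-- A faithful normal tracial state on a von Neumann algebra `M` acting on `H`.
Normality is ultraweak continuity: the functional is of the form
`a ↦ ∑ ⟪ξ n, a (η n)⟫` with square summable sequences `ξ`, `η` in `H`. -/
structure FaithfulNormalTrace (M : VonNeumannAlgebra H) where
  tr : M.toStarSubalgebra →ₗ[ℂ] ℂ
  tr_one : tr 1 = 1
  nonneg : ∀ a : M.toStarSubalgebra, (a : H →L[ℂ] H).IsPositive → 0 ≤ tr a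
  faithful : ∀ a : M.toStarSubalgebra, (a : H →L[ℂ] H).IsPositive → tr a = 0 → a = 0
  tr_mul_comm : ∀ a b : M.toStarSubalgebra, tr (a * b) = tr (b * a)
  normal : ∃ ξ η : ℕ → H, Summable (fun n => ‖ξ n‖ ^ 2) ∧ Summable (fun n => ‖η n‖ ^ 2) ∧
    ∀ a : M.toStarSubalgebra, HasSum (fun n => ⟪ξ n, (a : H →L[ℂ] H) (η n)⟫_ℂ) (tr a)

/-- `(R, τ)` is a copy of the hyperfinite `II₁`-factor with its trace: `R` is an infinite
dimensional factor with a faithful normal tracial state, and it is generated as a von Neumann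
algebra by an increasing sequence of full matrix algebras, which all contain the unit of `R`. -/
structure IsHyperfiniteIIOneFactor (R : VonNeumannAlgebra H) (_τ : FaithfulNormalTrace R) :
    Prop where
  factor : ∀ z : H →L[ℂ] H, z ∈ R → z ∈ R.commutant → ∃ c : ℂ, z = c • (1 : H →L[ℂ] H)
  infinite_dimensional : ¬ FiniteDimensional ℂ R.toStarSubalgebra
  hyperfinite : ∃ A : ℕ → StarSubalgebra ℂ (H →L[ℂ] H), Monotone A ∧
    (∀ j, ∃ k : ℕ, Nonempty (A j ≃⋆ₐ[ℂ] Matrix (Fin k) (Fin k) ℂ)) ∧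
    Set.centralizer (Set.centralizer (⋃ j, (A j : Set (H →L[ℂ] H)))) = (R : Set (H →L[ℂ] H))

/-- The tuple `x` consists of selfadjoint elements of `M`, and `M` is the von Neumann algebra
`x''` generated by it. -/
def IsSelfAdjointGenerating (M : VonNeumannAlgebra H) {n : ℕ}
    (x : Fin n → M.toStarSubalgebra) : Prop :=
  (∀ i, IsSelfAdjoint (x i)) ∧
    Set.centralizer (Set.centralizer (Set.range fun i => (x i : H →L[ℂ] H))) =
      (M : Set (H →L[ℂ] H))

end Trace

section Microstates

variable {H : Type u} [NormedAddCommGroup H] [InnerProductSpace ℂ H] [CompleteSpace H]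

/-- The normalized trace on the `k × k` matrices. -/
def normTrace {k : ℕ} (a : Matrix (Fin k) (Fin k) ℂ) : ℂ := a.trace / k

/-- The microstate space `Γ(X; m, k, γ)`. -/
def microstates {M : VonNeumannAlgebra H} (φ : FaithfulNormalTrace M) {n : ℕ}
    (x : Fin n → M.toStarSubalgebra) (m k : ℕ) (γ : ℝ) :
    Set (Fin n → Matrix (Fin k) (Fin k) ℂ) :=
  {a | (∀ i, (a i).IsHermitian) ∧
    ∀ p : ℕ, 1 ≤ p → p ≤ m → ∀ i : Fin p → Fin n,
      ‖normTrace (List.ofFn fun l => a (i l)).prod -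
        φ.tr (List.ofFn fun l => x (i l)).prod‖ < γ}

/-- The norm `|ξ|₂ = (∑ i, tr_k (ξ i ^ 2)) ^ (1 / 2)` of a tuple of selfadjoint matrices. -/
def tupleNorm {k n : ℕ} (ξ : Fin n → Matrix (Fin k) (Fin k) ℂ) : ℝ :=
  Real.sqrt (∑ i, (normTrace (ξ i ^ 2)).re)

/-- `N`-tubularity of the tuple `x`: for given `ε` there are `m` and `γ` such that among any
`N + 1` microstates in `Γ(X; m, k, γ)`, for any `k`, some two are unitarily conjugate up to `ε`. -/
def IsNTubular {M : VonNeumannAlgebra H} (φ : FaithfulNormalTrace M) {n : ℕ}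
    (x : Fin n → M.toStarSubalgebra) (N : ℕ) : Prop :=
  ∀ ε : ℝ, 0 < ε → ∃ m : ℕ, ∃ γ : ℝ, 0 < γ ∧
    ∀ k : ℕ, ∀ ξ : Fin (N + 1) → Fin n → Matrix (Fin k) (Fin k) ℂ,
      (∀ i, ξ i ∈ microstates φ x m k γ) →
      ∃ u ∈ Matrix.unitaryGroup (Fin k) ℂ, ∃ i j : Fin (N + 1), i < j ∧
        tupleNorm (fun l => u * ξ i l * star u - ξ j l) < ε

/-- Tubularity is `1`-tubularity. -/
def IsTubular {M : VonNeumannAlgebra H} (φ : FaithfulNormalTrace M) {n : ℕ}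
    (x : Fin n → M.toStarSubalgebra) : Prop :=
  IsNTubular φ x 1

end Microstates

section Ultrapower

variable {K : Type v} [NormedAddCommGroup K] [InnerProductSpace ℂ K] [CompleteSpace K]

/-- `ℓ^∞(R)`: the operator norm bounded sequences in `R`. -/
def boundedSeq (R : VonNeumannAlgebra K) : StarSubalgebra ℂ (ℕ → R.toStarSubalgebra) where
  carrier := {f | ∃ C : ℝ, ∀ n, ‖(f n : K →L[ℂ] K)‖ ≤ C}
  mul_mem' := by
    rintro f g ⟨C, hC⟩ ⟨D, hD⟩
    refine ⟨C * D, fun n => ?_⟩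
    have h0 : 0 ≤ C := (norm_nonneg _).trans (hC n)
    exact (norm_mul_le (f n : K →L[ℂ] K) (g n)).trans
      (mul_le_mul (hC n) (hD n) (norm_nonneg _) h0)
  add_mem' := by
    rintro f g ⟨C, hC⟩ ⟨D, hD⟩
    exact ⟨C + D, fun n =>
      (norm_add_le (f n : K →L[ℂ] K) (g n)).trans (add_le_add (hC n) (hD n))⟩
  algebraMap_mem' := by
    intro c
    exact ⟨‖algebraMap ℂ (K →L[ℂ] K) c‖, fun n => le_rfl⟩
  star_mem' := by
    rintro f ⟨C, hC⟩
    refine ⟨C, fun n => ?_⟩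
    have : ((star f n : R.toStarSubalgebra) : K →L[ℂ] K) = star (f n : K →L[ℂ] K) := rfl
    rw [this, norm_star]
    exact hC n

variable {R : VonNeumannAlgebra K} (τ : FaithfulNormalTrace R) (ω : Ultrafilter ℕ)

/-- `|a|₂² = τ(a* a)`. -/
def sqNorm (a : R.toStarSubalgebra) : ℝ := (τ.tr (star a * a)).re

theorem coe_star_mul_self (a : R.toStarSubalgebra) :
    ((star a * a : R.toStarSubalgebra) : K →L[ℂ] K) = star (a : K →L[ℂ] K) * (a : K →L[ℂ] K) := rfl

theorem isPositive_star_mul_self (a : R.toStarSubalgebra) :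
    ((star a * a : R.toStarSubalgebra) : K →L[ℂ] K).IsPositive :=
  ContinuousLinearMap.isPositive_adjoint_comp_self (a : K →L[ℂ] K)

theorem tr_star_mul_self_nonneg (a : R.toStarSubalgebra) : 0 ≤ τ.tr (star a * a) :=
  τ.nonneg _ (isPositive_star_mul_self a)

theorem sqNorm_nonneg (a : R.toStarSubalgebra) : 0 ≤ sqNorm τ a :=
  (Complex.le_def.1 (tr_star_mul_self_nonneg τ a)).1

theorem sqNorm_star (a : R.toStarSubalgebra) : sqNorm τ (star a) = sqNorm τ a := by
  unfold sqNorm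
  rw [star_star, τ.tr_mul_comm]

theorem sqNorm_add_le (a b : R.toStarSubalgebra) :
    sqNorm τ (a + b) ≤ 2 * sqNorm τ a + 2 * sqNorm τ b := by
  have h : sqNorm τ (a + b) + sqNorm τ (a - b) = 2 * sqNorm τ a + 2 * sqNorm τ b := by
    unfold sqNorm
    have : star (a + b) * (a + b) + star (a - b) * (a - b) =
        (star a * a + star a * a) + (star b * b + star b * b) := by
      rw [star_add, star_sub]; noncomm_ring
    have h2 := congrArg (fun z => (τ.tr z).re) this
    simp only [map_add, Complex.add_re] at h2 ⊢
    linarith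
  linarith [sqNorm_nonneg τ (a - b)]

theorem sqNorm_mul_le (a b : R.toStarSubalgebra) :
    sqNorm τ (a * b) ≤ ‖(a : K →L[ℂ] K)‖ ^ 2 * sqNorm τ b := by
  set c : ℝ := ‖(a : K →L[ℂ] K)‖ ^ 2 with hc
  have hpos : (((c : ℂ) • (star b * b) - star (a * b) * (a * b) : R.toStarSubalgebra) :
      K →L[ℂ] K).IsPositive := by
    rw [ContinuousLinearMap.isPositive_iff_complex]
    intro x
    have e : inner ℂ ((((c : ℂ) • (star b * b) - star (a * b) * (a * b) : R.toStarSubalgebra) :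
        K →L[ℂ] K) x) x =
        ((c * ‖(b : K →L[ℂ] K) x‖ ^ 2 - ‖(a : K →L[ℂ] K) ((b : K →L[ℂ] K) x)‖ ^ 2 : ℝ) : ℂ) := by
      have e1 : (((c : ℂ) • (star b * b) - star (a * b) * (a * b) : R.toStarSubalgebra) :
          K →L[ℂ] K) x = (c : ℂ) • (ContinuousLinearMap.adjoint (b : K →L[ℂ] K))
            ((b : K →L[ℂ] K) x) - (ContinuousLinearMap.adjoint
              ((a : K →L[ℂ] K) * (b : K →L[ℂ] K)))
            (((a : K →L[ℂ] K) * (b : K →L[ℂ] K)) x) := rfl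
      rw [e1, inner_sub_left, inner_smul_left, ContinuousLinearMap.adjoint_inner_left,
        ContinuousLinearMap.adjoint_inner_left, inner_self_eq_norm_sq_to_K,
        inner_self_eq_norm_sq_to_K]
      simp
    rw [e]
    refine ⟨rfl, ?_⟩
    have h1 := (a : K →L[ℂ] K).le_opNorm ((b : K →L[ℂ] K) x)
    have h2 := pow_le_pow_left₀ (norm_nonneg _) h1 2
    rw [mul_pow] at h2
    simp only [RCLike.re_to_complex, Complex.ofReal_re]
    linarith
  have h := (Complex.le_def.1 (τ.nonneg _ hpos)).1
  rw [map_sub, map_smul] at h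
  simp only [smul_eq_mul, Complex.sub_re, Complex.zero_re, Complex.re_ofReal_mul] at h
  unfold sqNorm
  linarith

/-- The ideal `{f | lim_ω |f n|₂ = 0}` of `ℓ^∞(R)`. -/
def nullIdeal : Ideal (boundedSeq R) where
  carrier := {f | Filter.Tendsto (fun n => sqNorm τ (f.1 n)) (ω : Filter ℕ) (nhds 0)}
  zero_mem' := by
    have : ∀ n, sqNorm τ ((0 : boundedSeq R).1 n) = 0 := fun n => by
      simp [sqNorm]
    simp only [Set.mem_ofPred_eq, this]
    exact tendsto_const_nhds
  add_mem' := by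
    intro f g hf hg
    have h := (hf.const_mul 2).add (hg.const_mul 2)
    simp only [mul_zero, add_zero] at h
    exact squeeze_zero (fun n => sqNorm_nonneg τ _) (fun n => sqNorm_add_le τ _ _) h
  smul_mem' := by
    rintro ⟨f, C, hC⟩ g hg
    have h := hg.const_mul (C ^ 2)
    rw [mul_zero] at h
    refine squeeze_zero (fun n => sqNorm_nonneg τ _) (fun n => ?_) h
    exact (sqNorm_mul_le τ (f n) (g.1 n)).trans (mul_le_mul_of_nonneg_right
      (pow_le_pow_left₀ (norm_nonneg _) (hC n) 2) (sqNorm_nonneg τ _))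

theorem mem_nullIdeal {f : boundedSeq R} : f ∈ nullIdeal τ ω ↔
    Filter.Tendsto (fun n => sqNorm τ (f.1 n)) (ω : Filter ℕ) (nhds 0) := Iff.rfl

theorem star_mem_nullIdeal {f : boundedSeq R} (hf : f ∈ nullIdeal τ ω) :
    star f ∈ nullIdeal τ ω := by
  rw [mem_nullIdeal] at hf ⊢
  exact hf.congr fun n => (sqNorm_star τ (f.1 n)).symm

instance : (nullIdeal τ ω).IsTwoSided where
  mul_mem_of_left {f} g hf := by
    have h := star_mem_nullIdeal τ ω
      ((nullIdeal τ ω).mul_mem_left (star g) (star_mem_nullIdeal τ ω hf))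
    simpa using h

/-- The tracial ultrapower `R^ω`: the quotient of `ℓ^∞(R)` by the sequences which tend to `0`
in `|·|₂` along `ω`. -/
def Ultrapower : Type v := boundedSeq R ⧸ nullIdeal τ ω

instance : Ring (Ultrapower τ ω) :=
  inferInstanceAs (Ring (boundedSeq R ⧸ nullIdeal τ ω))

/-- The quotient map `Q : ℓ^∞(R) → R^ω`. -/
def Q : boundedSeq R →+* Ultrapower τ ω := Ideal.Quotient.mk (nullIdeal τ ω)

theorem Q_surjective : Function.Surjective (Q τ ω) := Ideal.Quotient.mk_surjective

instance : Algebra ℂ (Ultrapower τ ω) :=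
  ((Q τ ω).comp (algebraMap ℂ (boundedSeq R))).toAlgebra' (by
    intro c a
    obtain ⟨f, rfl⟩ := Q_surjective τ ω a
    exact (((Q τ ω).map_mul _ _).symm.trans
      (congrArg (Q τ ω) (Algebra.commutes c f))).trans ((Q τ ω).map_mul _ _))

theorem Q_algebraMap (c : ℂ) :
    Q τ ω (algebraMap ℂ (boundedSeq R) c) = algebraMap ℂ (Ultrapower τ ω) c := rfl

theorem Q_eq_iff {f g : boundedSeq R} : Q τ ω f = Q τ ω g ↔ f - g ∈ nullIdeal τ ω :=
  Ideal.Quotient.mk_eq_mk_iff_sub_mem f g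

/-- The involution of `R^ω` is the one induced by that of `ℓ^∞(R)`. -/
instance : Star (Ultrapower τ ω) where
  star := Quotient.lift (fun f => Q τ ω (star f)) (by
    intro f g h
    have h' : f - g ∈ nullIdeal τ ω := by
      rw [← Submodule.quotientRel_def]; exact h
    rw [Q_eq_iff]
    have h2 := star_mem_nullIdeal τ ω h'
    rwa [star_sub (R := boundedSeq R)] at h2)

theorem star_Q (f : boundedSeq R) : star (Q τ ω f) = Q τ ω (star f) := rfl

theorem ultrapower_star_star (a : Ultrapower τ ω) : star (star a) = a := by
  obtain ⟨f, rfl⟩ := Q_surjective τ ω a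
  exact congrArg (Q τ ω) (star_star f)

theorem ultrapower_star_mul (a b : Ultrapower τ ω) : star (a * b) = star b * star a := by
  obtain ⟨f, rfl⟩ := Q_surjective τ ω a
  obtain ⟨g, rfl⟩ := Q_surjective τ ω b
  exact ((congrArg star ((Q τ ω).map_mul f g).symm).trans
    (congrArg (Q τ ω) (star_mul f g))).trans ((Q τ ω).map_mul (star g) (star f))

theorem ultrapower_star_add (a b : Ultrapower τ ω) : star (a + b) = star a + star b := by
  obtain ⟨f, rfl⟩ := Q_surjective τ ω a
  obtain ⟨g, rfl⟩ := Q_surjective τ ω b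
  exact ((congrArg star ((Q τ ω).map_add f g).symm).trans
    (congrArg (Q τ ω) (star_add f g))).trans ((Q τ ω).map_add (star f) (star g))

instance : StarRing (Ultrapower τ ω) where
  star_involutive := ultrapower_star_star τ ω
  star_mul := ultrapower_star_mul τ ω
  star_add := ultrapower_star_add τ ω

theorem tr_star (a : R.toStarSubalgebra) : τ.tr (star a) = star (τ.tr a) := by
  have him : ∀ c : ℂ, (starRingEnd ℂ c * τ.tr (star a) + c * τ.tr a).im = 0 := by
    intro c
    have h1 := (Complex.le_def.1 (tr_star_mul_self_nonneg τ (1 + c • a))).2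
    have h2 := (Complex.le_def.1 (tr_star_mul_self_nonneg τ (c • a))).2
    have e : star (1 + c • a) * (1 + c • a) =
        1 + (starRingEnd ℂ c • star a + c • a) + star (c • a) * (c • a) := by
      rw [star_add, star_one, star_smul, starRingEnd_apply]
      simp only [add_mul, mul_add, one_mul, mul_one]
      abel
    rw [e, map_add, map_add, map_add, map_smul, map_smul, τ.tr_one] at h1
    simp only [Complex.add_im, Complex.one_im, Complex.zero_im, smul_eq_mul] at h1 h2
    rw [Complex.add_im]
    linarith
  have h1 := him 1
  have h2 := him Complex.I
  simp at h1 h2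
  apply Complex.ext
  · simp; linarith
  · simp; linarith

theorem norm_tr_sq_le (a : R.toStarSubalgebra) : ‖τ.tr a‖ ^ 2 ≤ sqNorm τ a := by
  set c := τ.tr a with hc
  have h := (Complex.le_def.1 (tr_star_mul_self_nonneg τ (a - c • 1))).1
  have e : star (a - c • 1) * (a - c • 1) =
      star a * a - c • star a - star c • a + (star c * c) • 1 := by
    rw [star_sub, star_smul, star_one, sub_mul, mul_sub, mul_sub, mul_smul_comm, mul_one,
      smul_mul_assoc, one_mul, smul_mul_assoc, one_mul, smul_smul]
    abel
  rw [e, map_add, map_sub, map_sub, map_smul, map_smul, map_smul, tr_star, τ.tr_one, ← hc] at h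
  unfold sqNorm
  rw [← Complex.normSq_eq_norm_sq, Complex.normSq_apply]
  simp at h
  linarith

theorem exists_tendsto_tr (f : boundedSeq R) :
    ∃ z, Filter.Tendsto (fun n => τ.tr (f.1 n)) (ω : Filter ℕ) (nhds z) := by
  obtain ⟨f, C, hC⟩ := f
  have hb : ∀ n, τ.tr (f n) ∈ Metric.closedBall (0 : ℂ) |C| := by
    intro n
    rw [mem_closedBall_zero_iff]
    refine abs_le_of_sq_le_sq' ?_ (abs_nonneg C) |>.2
    have h := sqNorm_mul_le τ (f n) 1
    have h1 : sqNorm τ (1 : R.toStarSubalgebra) = 1 := by simp [sqNorm, τ.tr_one]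
    rw [mul_one, h1, mul_one] at h
    rw [sq_abs]
    exact ((norm_tr_sq_le τ (f n)).trans h).trans
      (pow_le_pow_left₀ (norm_nonneg _) (hC n) 2)
  obtain ⟨z, -, hz⟩ := (isCompact_closedBall (0 : ℂ) |C|).ultrafilter_le_nhds
    (ω.map fun n => τ.tr (f n))
    (Filter.le_principal_iff.2 (Filter.mem_map.2 (Filter.univ_mem' hb)))
  exact ⟨z, hz⟩

/-- The trace of `R^ω`, as a function on `ℓ^∞(R)`: the limit of the traces along `ω`. -/
def seqTrace (f : boundedSeq R) : ℂ := (exists_tendsto_tr τ ω f).choose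

theorem tendsto_seqTrace (f : boundedSeq R) :
    Filter.Tendsto (fun n => τ.tr (f.1 n)) (ω : Filter ℕ) (nhds (seqTrace τ ω f)) :=
  (exists_tendsto_tr τ ω f).choose_spec

/-- The trace `τ_ω` of `R^ω`. -/
def ultraTrace : Ultrapower τ ω → ℂ :=
  Quotient.lift (seqTrace τ ω) (by
    intro f g h
    have h' : f - g ∈ nullIdeal τ ω := by
      rw [← Submodule.quotientRel_def]; exact h
    have h1 := (tendsto_seqTrace τ ω f).sub (tendsto_seqTrace τ ω g)
    have h2 : Filter.Tendsto (fun n => τ.tr (f.1 n) - τ.tr (g.1 n)) (ω : Filter ℕ) (nhds 0) := by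
      rw [tendsto_zero_iff_norm_tendsto_zero]
      have h3 := (Real.continuous_sqrt.tendsto 0).comp ((mem_nullIdeal τ ω).1 h')
      rw [Real.sqrt_zero] at h3
      refine squeeze_zero (fun n => norm_nonneg _) (fun n => ?_) h3
      rw [← map_sub]
      exact Real.le_sqrt_of_sq_le (norm_tr_sq_le τ _)
    exact sub_eq_zero.1 (tendsto_nhds_unique h1 h2))

theorem ultraTrace_Q (f : boundedSeq R) : ultraTrace τ ω (Q τ ω f) = seqTrace τ ω f := rfl

end Ultrapower

section Embedding

/-- The order of a `C*`-algebra: `a ≤ b` if and only if `b - a = z* z` for some `z`. -/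
def StarLE {A : Type*} [Ring A] [StarRing A] (a b : A) : Prop := ∃ z : A, b - a = star z * z

/-- `a` is the least upper bound of `S` in the order of the `C*`-algebra `A`. -/
def IsStarSup {A : Type*} [Ring A] [StarRing A] (S : Set A) (a : A) : Prop :=
  (∀ s ∈ S, StarLE s a) ∧ ∀ b, (∀ s ∈ S, StarLE s b) → StarLE a b

/-- Normality of a map between von Neumann algebras: it preserves suprema of increasing
nets of selfadjoint elements. -/
def IsNormalMap {A B : Type*} [Ring A] [StarRing A] [Ring B] [StarRing B] (f : A → B) : Prop :=
  ∀ (S : Set A) (a : A), S.Nonempty → DirectedOn StarLE S → (∀ s ∈ S, IsSelfAdjoint s) →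
    IsStarSup S a → IsStarSup (f '' S) (f a)

variable {H : Type u} [NormedAddCommGroup H] [InnerProductSpace ℂ H] [CompleteSpace H]
variable {K : Type v} [NormedAddCommGroup K] [InnerProductSpace ℂ K] [CompleteSpace K]

/-- A unital `*`-homomorphism `π : M → R^ω` is an embedding if it is injective, normal, and
preserves the traces. -/
def IsTracialEmbedding {M : VonNeumannAlgebra H} (φ : FaithfulNormalTrace M)
    {R : VonNeumannAlgebra K} (τ : FaithfulNormalTrace R) (ω : Ultrafilter ℕ)
    (π : M.toStarSubalgebra →⋆ₐ[ℂ] Ultrapower τ ω) : Prop :=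
  Function.Injective π ∧ IsNormalMap π ∧ ∀ a, ultraTrace τ ω (π a) = φ.tr a

end Embedding

end Tubular

end

/-!
Lift `σ (x i)` and `π (x i)` to bounded sequences of selfadjoint elements `f i j` and `g i j` of `R`.
Because `σ` and `π` preserve the trace, the moments of these tuples converge to those of `x` along
`ω`. The tuples in `R` are moved into a matrix algebra by the trace preserving conditional
expectations `condExp` onto an increasing sequence of matrix subalgebras with dense union. Density
in the trace norm comes from the bicommutant theorem (`exists_mem_norm_amplify_sub_lt`, proved by
amplification to a Hilbert sum) and the normality of the trace. Moments survive the conditional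
expectation (`tendsto_sqNorm_prod_condExp`), so it produces microstates, and tubularity yields a
matrix unitary which conjugates one tuple to the other up to a small error in the trace norm
(`exists_unitary_conj_of_isTubular`).

Choosing such unitaries with errors tending to `0` along the nonprincipal ultrafilter `ω` gives a
unitary `u` of `R^ω` with `σ (x i) = u * π (x i) * star u` (`exists_unitary_conj_generators`). The
identity holds on the `*`-algebra generated by the `x i`. That algebra is dense in `M` for the trace
norm, again by the bicommutant theorem, and `σ` and `π` are isometric for this norm, which is faithful
on `R^ω`, so the identity holds on `M` (`conj_of_conj_generators`).
-/

namespace Tubular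

/-! ### Density of a `*`-algebra in its bicommutant -/

section Amplification

variable {H ι : Type*} [NormedAddCommGroup H] [InnerProductSpace ℂ H]

theorem memℓp_comp (a : H →L[ℂ] H) (x : lp (fun _ : ι => H) 2) :
    Memℓp (fun i => a (x i)) 2 := by
  have hx := (lp.memℓp x).summable (by norm_num)
  refine memℓp_gen (Summable.of_nonneg_of_le (fun i => by positivity) (fun i => ?_)
    (hx.mul_left (‖a‖ ^ (2 : ENNReal).toReal)))
  rw [← Real.mul_rpow (norm_nonneg _) (norm_nonneg _)]
  exact Real.rpow_le_rpow (norm_nonneg _) (a.le_opNorm _) (by norm_num)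

/-- The amplification `1 ⊗ a` of an operator `a` on `H` to the Hilbert sum `ℓ²(ι, H)`. -/
noncomputable def amplify (a : H →L[ℂ] H) :
    lp (fun _ : ι => H) 2 →ₗ[ℂ] lp (fun _ : ι => H) 2 where
  toFun x := ⟨fun i => a (x i), memℓp_comp a x⟩
  map_add' x y := by ext i; exact a.map_add _ _
  map_smul' c x := by ext i; exact a.map_smul _ _

@[simp]
theorem amplify_apply (a : H →L[ℂ] H) (x : lp (fun _ : ι => H) 2) (i : ι) :
    amplify a x i = a (x i) := rfl

theorem hasSum_norm_amplify_sq (a : H →L[ℂ] H) (x : lp (fun _ : ι => H) 2) :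
    HasSum (fun i => ‖a (x i)‖ ^ 2) (‖amplify a x‖ ^ 2) := by
  simpa using lp.hasSum_norm (p := 2) (by norm_num) (amplify a x)

theorem exists_lp_sum_elim {H : Type*} [NormedAddCommGroup H] {ξ η : ℕ → H}
    (hξ : Summable fun n => ‖ξ n‖ ^ 2) (hη : Summable fun n => ‖η n‖ ^ 2) :
    ∃ x : lp (fun _ : ℕ ⊕ ℕ => H) 2,
      (∀ n, x (Sum.inl n) = ξ n) ∧ ∀ n, x (Sum.inr n) = η n := by
  have hmem : Memℓp (E := fun _ : ℕ ⊕ ℕ => H) (Sum.elim ξ η) 2 := by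
    refine memℓp_gen ((Summable.sum (Sum.elim (fun n => ‖ξ n‖ ^ 2) fun n => ‖η n‖ ^ 2)
      hξ hη).congr ?_)
    rintro (i | i) <;> simp
  exact ⟨⟨_, hmem⟩, fun _ => rfl, fun _ => rfl⟩

theorem starProjection_amplify (a : H →L[ℂ] H) (W : Submodule ℂ (lp (fun _ : ι => H) 2))
    [W.HasOrthogonalProjection] (h1 : ∀ x ∈ W, amplify a x ∈ W)
    (h2 : ∀ x ∈ Wᗮ, amplify a x ∈ Wᗮ) (x : lp (fun _ : ι => H) 2) :
    W.starProjection (amplify a x) = amplify a (W.starProjection x) := by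
  refine (Submodule.eq_starProjection_of_mem_orthogonal
    (h1 _ (W.starProjection_apply_mem x)) ?_)
  rw [← map_sub]
  exact h2 _ (W.sub_starProjection_mem_orthogonal x)

/-- A continuous operator on `ℓ²(ι, H)` which commutes with the amplifications of all `b ∈ B`
commutes with the amplifications of the elements of `B''`: its matrix coefficients lie in `B'`. -/
theorem amplify_comm_of_mem_bicommutant (B : Set (H →L[ℂ] H)) {a : H →L[ℂ] H}
    (ha : a ∈ Set.centralizer (Set.centralizer B))
    (P : lp (fun _ : ι => H) 2 →L[ℂ] lp (fun _ : ι => H) 2)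
    (hP : ∀ b ∈ B, ∀ x, P (amplify b x) = amplify b (P x)) (x : lp (fun _ : ι => H) 2) :
    P (amplify a x) = amplify a (P x) := by
  classical
  let S : ι → H →L[ℂ] lp (fun _ : ι => H) 2 := fun i =>
    lp.singleContinuousLinearMap ℂ (fun _ : ι => H) 2 i
  -- `V m ∘ P ∘ S i` is the `(m, i)` matrix coefficient of `P`.
  let V : ι → lp (fun _ : ι => H) 2 →L[ℂ] H := fun i => lp.evalCLM ℂ (fun _ : ι => H) 2 i
  have hS : ∀ (c : H →L[ℂ] H) i h, S i (c h) = amplify c (S i h) := by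
    intro c i h
    ext m
    by_cases hm : m = i
    · subst hm; simp [S]
    · simp [S, Pi.single_eq_of_ne hm]
  have hcoef : ∀ m i h, V m (P (S i (a h))) = a (V m (P (S i h))) := by
    intro m i h
    have hc : V m ∘L P ∘L S i ∈ Set.centralizer B := by
      intro b hb
      ext h
      change b (V m (P (S i h))) = V m (P (S i (b h)))
      rw [hS, hP b hb]
      rfl
    have := congrArg (fun T : H →L[ℂ] H => T h) (ha _ hc)
    exact this
  ext m
  have h1 := ((V m ∘L P).hasSum (lp.hasSum_single ENNReal.ofNat_ne_top (amplify a x)))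
  have h2 := ((a ∘L V m ∘L P).hasSum (lp.hasSum_single ENNReal.ofNat_ne_top x))
  exact h1.unique (h2.congr_fun fun i => hcoef m i (x i))

variable [CompleteSpace H]

theorem inner_amplify_left (a : H →L[ℂ] H) (x y : lp (fun _ : ι => H) 2) :
    ⟪amplify a x, y⟫_ℂ = ⟪x, amplify (star a) y⟫_ℂ := by
  rw [lp.inner_eq_tsum, lp.inner_eq_tsum]
  refine tsum_congr fun i => ?_
  rw [amplify_apply, amplify_apply, ContinuousLinearMap.star_eq_adjoint,
    ContinuousLinearMap.adjoint_inner_right]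

theorem amplify_mem_orthogonal (a : H →L[ℂ] H) {U : Submodule ℂ (lp (fun _ : ι => H) 2)}
    (hU : ∀ x ∈ U, amplify (star a) x ∈ U) : ∀ x ∈ Uᗮ, amplify a x ∈ Uᗮ := by
  intro x hx
  rw [Submodule.mem_orthogonal'] at hx ⊢
  intro u hu
  rw [inner_amplify_left]
  exact hx _ (hU u hu)

/-- The density half of the bicommutant theorem, in the form needed for normal functionals:
elements of `B''` are approximated by elements of the unital `*`-algebra `B`
simultaneously on a square summable family of vectors. -/
theorem exists_mem_norm_amplify_sub_lt (B : StarSubalgebra ℂ (H →L[ℂ] H)) {a : H →L[ℂ] H}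
    (ha : a ∈ Set.centralizer (Set.centralizer (B : Set (H →L[ℂ] H))))
    (x : lp (fun _ : ι => H) 2) {ε : ℝ} (hε : 0 < ε) :
    ∃ b ∈ B, ‖amplify (a - b) x‖ < ε := by
  -- `U` is the orbit of `x` under `1 ⊗ B`. The projection onto `Uᗮ` kills `x`, commutes with
  -- `1 ⊗ B`, hence with `1 ⊗ a`, and so kills `(1 ⊗ a) x`, which therefore lies in the closure of `U`.
  let ev : (H →L[ℂ] H) →ₗ[ℂ] lp (fun _ : ι => H) 2 :=
    { toFun := fun b => amplify b x
      map_add' := fun b c => by ext i; simp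
      map_smul' := fun c b => by ext i; simp }
  let U : Submodule ℂ (lp (fun _ : ι => H) 2) :=
    (Subalgebra.toSubmodule B.toSubalgebra).map ev
  have hU : ∀ b ∈ B, ∀ y ∈ U, amplify b y ∈ U := by
    rintro b hb _ ⟨c, hc, rfl⟩
    exact ⟨b * c, B.mul_mem hb hc, rfl⟩
  have hW : ∀ b ∈ B, ∀ y ∈ Uᗮ, amplify b y ∈ Uᗮ := fun b hb =>
    amplify_mem_orthogonal b (hU _ (star_mem hb))
  have hW' : ∀ b ∈ B, ∀ y ∈ Uᗮᗮ, amplify b y ∈ Uᗮᗮ := fun b hb =>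
    amplify_mem_orthogonal b (hW _ (star_mem hb))
  have hxU : x ∈ U := ⟨1, B.one_mem, rfl⟩
  have hPx : Uᗮ.starProjection x = 0 := by
    rw [Submodule.starProjection_apply_eq_zero_iff]
    exact U.le_orthogonal_orthogonal hxU
  have hcomm := amplify_comm_of_mem_bicommutant (B : Set (H →L[ℂ] H)) ha Uᗮ.starProjection
    (fun b hb => starProjection_amplify b Uᗮ (hW b hb) (hW' b hb)) x
  rw [hPx, map_zero, Submodule.starProjection_apply_eq_zero_iff,
    Submodule.orthogonal_orthogonal_eq_closure, ← SetLike.mem_coe,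
    Submodule.topologicalClosure_coe, Metric.mem_closure_iff] at hcomm
  obtain ⟨_, ⟨b, hb, rfl⟩, h⟩ := hcomm ε hε
  refine ⟨b, hb, ?_⟩
  rw [dist_eq_norm] at h
  have e : amplify (a - b) x = amplify a x - ev b := by ext i; simp [ev]
  rwa [e]

end Amplification

section TraceDensity

variable {H : Type*} [NormedAddCommGroup H] [InnerProductSpace ℂ H] [CompleteSpace H]
variable {M : VonNeumannAlgebra H} (φ : FaithfulNormalTrace M)

/-- Normality of the trace bounds the trace norm by the norm on a Hilbert sum. -/
theorem exists_sqNorm_le_amplify :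
    ∃ x : lp (fun _ : ℕ ⊕ ℕ => H) 2, ∀ a : M.toStarSubalgebra,
      sqNorm φ a ≤ ‖amplify (a : H →L[ℂ] H) x‖ ^ 2 := by
  obtain ⟨ξ, η, hξ, hη, h⟩ := φ.normal
  obtain ⟨x, hxl, hxr⟩ := exists_lp_sum_elim hξ hη
  refine ⟨x, fun a => ?_⟩
  have hs := hasSum_norm_amplify_sq (a : H →L[ℂ] H) x
  have hsl := hs.summable.comp_injective (Sum.inl_injective (α := ℕ) (β := ℕ))
  have hsr := hs.summable.comp_injective (Sum.inr_injective (α := ℕ) (β := ℕ))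
  have h2 : HasSum (fun i => ‖(a : H →L[ℂ] H) (x i)‖ ^ 2) _ :=
    HasSum.sum (f := fun i => ‖(a : H →L[ℂ] H) (x i)‖ ^ 2) hsl.hasSum hsr.hasSum
  rw [hs.unique h2]
  refine hasSum_le (fun n => ?_) (Complex.hasSum_re (h (star a * a)))
    (hsl.hasSum.add hsr.hasSum)
  have e : ⟪ξ n, ((star a * a : M.toStarSubalgebra) : H →L[ℂ] H) (η n)⟫_ℂ =
      ⟪(a : H →L[ℂ] H) (ξ n), (a : H →L[ℂ] H) (η n)⟫_ℂ := by
    change ⟪ξ n, ContinuousLinearMap.adjoint (a : H →L[ℂ] H) ((a : H →L[ℂ] H) (η n))⟫_ℂ = _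
    rw [ContinuousLinearMap.adjoint_inner_right]
  rw [e]
  refine (Complex.re_le_norm _).trans ((norm_inner_le_norm _ _).trans ?_)
  simp only [Function.comp_apply, hxl, hxr]
  nlinarith [sq_nonneg (‖(a : H →L[ℂ] H) (ξ n)‖ - ‖(a : H →L[ℂ] H) (η n)‖),
    sq_nonneg (‖(a : H →L[ℂ] H) (ξ n)‖ + ‖(a : H →L[ℂ] H) (η n)‖)]

/-- A unital `*`-algebra with bicommutant `M` is dense in `M` for the trace norm. -/
theorem exists_sqNorm_sub_lt (B : StarSubalgebra ℂ (H →L[ℂ] H))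
    (hB : Set.centralizer (Set.centralizer (B : Set (H →L[ℂ] H))) = (M : Set (H →L[ℂ] H)))
    (a : M.toStarSubalgebra) {ε : ℝ} (hε : 0 < ε) :
    ∃ b : M.toStarSubalgebra, (b : H →L[ℂ] H) ∈ B ∧ sqNorm φ (a - b) < ε := by
  obtain ⟨x, hx⟩ := exists_sqNorm_le_amplify φ
  have ha : (a : H →L[ℂ] H) ∈ Set.centralizer (Set.centralizer (B : Set (H →L[ℂ] H))) := by
    rw [hB]; exact a.2
  obtain ⟨b, hb, h⟩ := exists_mem_norm_amplify_sub_lt B ha x (Real.sqrt_pos.2 hε)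
  have hbM : b ∈ M.toStarSubalgebra := by
    have : b ∈ (M : Set (H →L[ℂ] H)) := hB ▸ Set.subset_centralizer_centralizer hb
    exact this
  refine ⟨⟨b, hbM⟩, hb, (hx _).trans_lt ?_⟩
  have := pow_lt_pow_left₀ h (norm_nonneg _) two_ne_zero
  rwa [Real.sq_sqrt hε.le] at this

end TraceDensity

/-! ### The trace norm -/

section TraceNorm

variable {K : Type*} [NormedAddCommGroup K] [InnerProductSpace ℂ K] [CompleteSpace K]
variable {R : VonNeumannAlgebra K} (τ : FaithfulNormalTrace R)

theorem sqNorm_sub_comm (a b : R.toStarSubalgebra) : sqNorm τ (a - b) = sqNorm τ (b - a) := by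
  unfold sqNorm
  rw [← neg_sub b a, star_neg, neg_mul_neg]

theorem sqNorm_sub_le (a b c : R.toStarSubalgebra) :
    sqNorm τ (a - c) ≤ 2 * sqNorm τ (a - b) + 2 * sqNorm τ (b - c) := by
  simpa using sqNorm_add_le τ (a - b) (b - c)

theorem sqNorm_unitary_conj {u : R.toStarSubalgebra} (hu : u ∈ unitary R.toStarSubalgebra)
    (a : R.toStarSubalgebra) : sqNorm τ (u * a * star u) = sqNorm τ a := by
  have h1 : star u * u = 1 := (Unitary.mem_iff.1 hu).1
  unfold sqNorm
  have e : star (u * a * star u) * (u * a * star u) = u * (star a * a * star u) := by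
    simp only [star_mul, star_star]
    calc u * (star a * star u) * (u * a * star u) = u * star a * (star u * u) * a * star u := by
          noncomm_ring
      _ = _ := by rw [h1]; noncomm_ring
  rw [e, τ.tr_mul_comm, mul_assoc, h1, mul_one]

end TraceNorm

/-! ### Matrix subalgebras and their conditional expectations -/

section Matrices

open Matrix

/-- The normalized trace is the only tracial functional on matrices with value `1` at `1`. -/
theorem eq_normTrace_of_tracial {k : ℕ} (hk : k ≠ 0) (f : Matrix (Fin k) (Fin k) ℂ →ₗ[ℂ] ℂ)
    (h1 : f 1 = 1) (hf : ∀ a b, f (a * b) = f (b * a)) (a : Matrix (Fin k) (Fin k) ℂ) :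
    f a = normTrace a := by
  have hk' : (k : ℂ) ≠ 0 := Nat.cast_ne_zero.2 hk
  have : NeZero k := ⟨hk⟩
  have hoff : ∀ i j, i ≠ j → f (single i j 1) = 0 := by
    intro i j hij
    have h := hf (single i i 1) (single i j 1)
    rw [single_mul_single_same, single_mul_single_of_ne _ _ _ _ hij.symm, map_zero, mul_one] at h
    exact h
  have hdiag : ∀ i j, f (single i i 1) = f (single j j 1) := by
    intro i j
    have h := hf (single i j 1) (single j i 1)
    rwa [single_mul_single_same, single_mul_single_same, mul_one] at h
  have hd : ∀ i, f (single i i 1) = 1 / k := by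
    intro i
    have h : f 1 = ∑ j, f (single j j 1) := by
      rw [← map_sum, sum_single_eq_diagonal]; rfl
    rw [h1, Finset.sum_congr rfl fun j _ => hdiag j i] at h
    simp at h
    field_simp
    rw [mul_comm]; exact h.symm
  have hs : ∀ i j, f (single i j (a i j)) = a i j * f (single i j 1) := by
    intro i j
    rw [← smul_eq_mul, ← map_smul, smul_single, smul_eq_mul, mul_one]
  rw [matrix_eq_sum_single a, map_sum]
  simp only [map_sum]
  rw [← matrix_eq_sum_single a]
  simp only [hs]
  unfold normTrace Matrix.trace
  rw [Finset.sum_div]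
  refine Finset.sum_congr rfl fun i _ => ?_
  rw [Finset.sum_eq_single i (fun j _ hj => by rw [hoff i j hj.symm, mul_zero]) (by simp), hd,
    diag_apply]
  ring

theorem normTrace_mul_comm {k : ℕ} (a b : Matrix (Fin k) (Fin k) ℂ) :
    normTrace (a * b) = normTrace (b * a) := by
  unfold normTrace; rw [trace_mul_comm]

theorem normTrace_star {k : ℕ} (a : Matrix (Fin k) (Fin k) ℂ) :
    normTrace (star a) = star (normTrace a) := by
  simp [normTrace, star_eq_conjTranspose, trace_conjTranspose]

theorem eq_of_normTrace_mul_eq {k : ℕ} (hk : k ≠ 0) {a b : Matrix (Fin k) (Fin k) ℂ}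
    (h : ∀ c, normTrace (c * a) = normTrace (c * b)) : a = b := by
  have hk' : (k : ℂ) ≠ 0 := Nat.cast_ne_zero.2 hk
  rw [ext_iff_trace_mul_left]
  intro c
  have := h c
  unfold normTrace at this
  exact (div_left_inj' hk').1 this

variable {K : Type*} [NormedAddCommGroup K] [InnerProductSpace ℂ K] [CompleteSpace K]
variable {R : VonNeumannAlgebra K} (τ : FaithfulNormalTrace R)

theorem ne_zero_of_starAlgHom {k : ℕ} (τ : FaithfulNormalTrace R)
    (e : Matrix (Fin k) (Fin k) ℂ →⋆ₐ[ℂ] R.toStarSubalgebra) : k ≠ 0 := by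
  rintro rfl
  have h : (1 : R.toStarSubalgebra) = 0 := by
    rw [← map_one e, ← map_zero e]
    exact congrArg e (Subsingleton.elim _ _)
  have := τ.tr_one
  rw [h, map_zero] at this
  exact zero_ne_one this

variable {k : ℕ} (e : Matrix (Fin k) (Fin k) ℂ →⋆ₐ[ℂ] R.toStarSubalgebra)

/-- The trace of `R` restricts to the normalized trace on every copy of the matrices in `R`. -/
theorem tr_starAlgHom (b : Matrix (Fin k) (Fin k) ℂ) : τ.tr (e b) = normTrace b := by
  refine eq_normTrace_of_tracial (ne_zero_of_starAlgHom τ e)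
    (τ.tr ∘ₗ e.toAlgHom.toLinearMap) ?_ (fun a b => ?_) b
  · change τ.tr (e 1) = 1
    rw [map_one, τ.tr_one]
  · change τ.tr (e (a * b)) = τ.tr (e (b * a))
    rw [map_mul e, map_mul e, τ.tr_mul_comm]

/-- The trace preserving conditional expectation of `R` onto the copy `e (M_k)` of the
`k × k` matrices in `R`, as a map with values in the matrices. Its entries are the ones forced
by `tr_k (b (condExp a)) = τ (e b * a)` for matrix units `b`. -/
noncomputable def condExp (a : R.toStarSubalgebra) : Matrix (Fin k) (Fin k) ℂ :=
  Matrix.of fun i j => k * τ.tr (e (single j i 1) * a)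

theorem normTrace_mul_condExp (b : Matrix (Fin k) (Fin k) ℂ) (a : R.toStarSubalgebra) :
    normTrace (b * condExp τ e a) = τ.tr (e b * a) := by
  have hk' : (k : ℂ) ≠ 0 := Nat.cast_ne_zero.2 (ne_zero_of_starAlgHom τ e)
  induction b using Matrix.induction_on' with
  | h_zero => simp [normTrace]
  | h_add p q hp hq =>
    rw [map_add, add_mul, add_mul, map_add, ← hp, ← hq]
    simp [normTrace, add_div]
  | h_std_basis i j c =>
    have hc : single i j c = c • single i j (1 : ℂ) := by
      rw [smul_single, smul_eq_mul, mul_one]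
    rw [hc, map_smul, smul_mul_assoc, smul_mul_assoc, map_smul]
    simp only [normTrace, trace_smul, trace_single_mul, condExp, of_apply, smul_eq_mul, one_mul]
    field_simp

theorem condExp_unique {a : R.toStarSubalgebra} {t : Matrix (Fin k) (Fin k) ℂ}
    (h : ∀ b, normTrace (b * t) = τ.tr (e b * a)) : condExp τ e a = t :=
  eq_of_normTrace_mul_eq (ne_zero_of_starAlgHom τ e) fun b => by
    rw [h, normTrace_mul_condExp]

theorem condExp_mul_right (a : R.toStarSubalgebra) (c : Matrix (Fin k) (Fin k) ℂ) :
    condExp τ e (a * e c) = condExp τ e a * c := by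
  refine condExp_unique τ e fun b => ?_
  rw [← mul_assoc, normTrace_mul_comm, ← mul_assoc, normTrace_mul_condExp, map_mul e,
    ← mul_assoc, τ.tr_mul_comm (e b * a), ← mul_assoc]

theorem condExp_star (a : R.toStarSubalgebra) : condExp τ e (star a) = star (condExp τ e a) := by
  refine condExp_unique τ e fun b => ?_
  have h := normTrace_mul_condExp τ e (star b) a
  have h2 : b * star (condExp τ e a) = star (condExp τ e a * star b) := by
    rw [star_mul, star_star]
  rw [h2, normTrace_star, normTrace_mul_comm, h, ← tr_star, star_mul, ← map_star, star_star,
    τ.tr_mul_comm]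

theorem condExp_sub (a b : R.toStarSubalgebra) :
    condExp τ e (a - b) = condExp τ e a - condExp τ e b := by
  refine condExp_unique τ e fun c => ?_
  rw [mul_sub, mul_sub, map_sub, ← normTrace_mul_condExp, ← normTrace_mul_condExp]
  simp [normTrace, sub_div]

theorem isHermitian_condExp {a : R.toStarSubalgebra} (ha : IsSelfAdjoint a) :
    (condExp τ e a).IsHermitian := by
  have h := condExp_star τ e a
  rw [ha.star_eq] at h
  exact h.symm

/-- Pythagoras: `condExp` is the orthogonal projection for the trace norm. -/
theorem sqNorm_sub_eq (a : R.toStarSubalgebra) (b : Matrix (Fin k) (Fin k) ℂ) :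
    sqNorm τ (a - e b) = sqNorm τ (a - e (condExp τ e a)) + sqNorm τ (e (condExp τ e a - b)) := by
  set t := condExp τ e a with ht
  have hz : ∀ c, τ.tr (e c * (a - e t)) = 0 := by
    intro c
    rw [mul_sub, map_sub, ← map_mul, tr_starAlgHom, ← normTrace_mul_condExp, sub_self]
  have hz' : ∀ c, τ.tr (star (a - e t) * e c) = 0 := by
    intro c
    have : star (a - e t) * e c = star (e (star c) * (a - e t)) := by
      rw [star_mul, ← map_star, star_star]
    rw [this, tr_star, hz, star_zero]
  have hsplit : a - e b = (a - e t) + e (t - b) := by rw [map_sub]; abel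
  unfold sqNorm
  rw [hsplit, star_add, add_mul, mul_add, mul_add, map_add, map_add, map_add, hz', ← map_star e,
    hz]
  simp

theorem sqNorm_sub_condExp_le (a : R.toStarSubalgebra) (b : Matrix (Fin k) (Fin k) ℂ) :
    sqNorm τ (a - e (condExp τ e a)) ≤ sqNorm τ (a - e b) := by
  rw [sqNorm_sub_eq τ e a b]
  exact le_add_of_nonneg_right (sqNorm_nonneg τ _)

theorem sqNorm_condExp_le (a : R.toStarSubalgebra) :
    sqNorm τ (e (condExp τ e a)) ≤ sqNorm τ a := by
  have h := sqNorm_sub_eq τ e a 0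
  rw [map_zero, sub_zero, sub_zero] at h
  rw [h]
  exact le_add_of_nonneg_left (sqNorm_nonneg τ _)

theorem unitary_starAlgHom {u : Matrix (Fin k) (Fin k) ℂ} (hu : u ∈ Matrix.unitaryGroup (Fin k) ℂ) :
    e u ∈ unitary R.toStarSubalgebra := by
  have h := Unitary.mem_iff.1 hu
  rw [Unitary.mem_iff, ← map_star, ← map_mul, ← map_mul, h.1, h.2, map_one]
  exact ⟨rfl, rfl⟩

end Matrices

/-! ### Approximation in the hyperfinite factor -/

section Hyperfinite

open Filter Topology

variable {K : Type*} [NormedAddCommGroup K] [InnerProductSpace ℂ K] [CompleteSpace K]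
variable {R : VonNeumannAlgebra K} (τ : FaithfulNormalTrace R)

theorem tendsto_tr_of_tendsto_sqNorm {α : Type*} {F : Filter α} {z : α → R.toStarSubalgebra}
    {a : R.toStarSubalgebra} (h : Tendsto (fun l => sqNorm τ (z l - a)) F (𝓝 0)) :
    Tendsto (fun l => τ.tr (z l)) F (𝓝 (τ.tr a)) := by
  rw [tendsto_iff_norm_sub_tendsto_zero]
  have h3 := (Real.continuous_sqrt.tendsto 0).comp h
  rw [Real.sqrt_zero] at h3
  refine squeeze_zero (fun n => norm_nonneg _) (fun n => ?_) h3
  rw [← map_sub]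
  exact Real.le_sqrt_of_sq_le (norm_tr_sq_le τ _)

/-- In the hyperfinite factor there is a sequence of matrix subalgebras whose conditional
expectations converge to the identity, pointwise in the trace norm. -/
theorem exists_tendsto_condExp (hR : IsHyperfiniteIIOneFactor R τ) :
    ∃ (k : ℕ → ℕ) (e : ∀ l, Matrix (Fin (k l)) (Fin (k l)) ℂ →⋆ₐ[ℂ] R.toStarSubalgebra),
      ∀ a, Tendsto (fun l => sqNorm τ (a - e l (condExp τ (e l) a))) atTop (𝓝 0) := by
  obtain ⟨A, hA, hk, hgen⟩ := hR.hyperfinite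
  choose k hk using hk
  have hAR : ∀ l, ∀ b ∈ A l, b ∈ R.toStarSubalgebra := by
    intro l b hb
    have : b ∈ (R : Set (K →L[ℂ] K)) := by
      rw [← hgen]
      exact Set.subset_centralizer_centralizer (Set.mem_iUnion.2 ⟨l, hb⟩)
    exact this
  let E : ∀ l, A l ≃⋆ₐ[ℂ] Matrix (Fin (k l)) (Fin (k l)) ℂ := fun l => (hk l).some
  let e : ∀ l, Matrix (Fin (k l)) (Fin (k l)) ℂ →⋆ₐ[ℂ] R.toStarSubalgebra := fun l =>
    (StarSubalgebra.inclusion (hAR l)).comp ((E l).symm : _ →⋆ₐ[ℂ] A l)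
  have he : ∀ l (b : R.toStarSubalgebra), (b : K →L[ℂ] K) ∈ A l → ∃ t, e l t = b := by
    intro l b hb
    refine ⟨E l ⟨b, hb⟩, ?_⟩
    change StarSubalgebra.inclusion (hAR l) ((E l).symm (E l ⟨b, hb⟩)) = b
    rw [StarAlgEquiv.symm_apply_apply]
    rfl
  refine ⟨k, e, fun a => ?_⟩
  have hU : ((⨆ l, A l : StarSubalgebra ℂ (K →L[ℂ] K)) : Set (K →L[ℂ] K)) = ⋃ l, (A l : Set _) :=
    StarSubalgebra.coe_iSup_of_directed hA.directed_le
  rw [← hU] at hgen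
  rw [Metric.tendsto_atTop]
  intro ε hε
  obtain ⟨b, hb, hlt⟩ := exists_sqNorm_sub_lt τ _ hgen a hε
  rw [← SetLike.mem_coe, hU, Set.mem_iUnion] at hb
  obtain ⟨L, hL⟩ := hb
  refine ⟨L, fun l hl => ?_⟩
  obtain ⟨t, ht⟩ := he l b (hA hl hL)
  rw [Real.dist_eq, sub_zero, abs_of_nonneg (sqNorm_nonneg τ _)]
  exact (sqNorm_sub_condExp_le τ (e l) a t).trans_lt (by rwa [ht])

variable {k : ℕ → ℕ} {e : ∀ l, Matrix (Fin (k l)) (Fin (k l)) ℂ →⋆ₐ[ℂ] R.toStarSubalgebra}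

/-- Words in the conditional expectations converge to the words in the original elements. No
bound on the operator norms of the expectations is needed: the expectation is a right module map,
so that `E(a) * E(w) = E(a * E(w))`, and it is contractive in the trace norm. -/
theorem tendsto_sqNorm_prod_condExp
    (he : ∀ a, Tendsto (fun l => sqNorm τ (a - e l (condExp τ (e l) a))) atTop (𝓝 0))
    (w : List R.toStarSubalgebra) :
    Tendsto (fun l => sqNorm τ (e l (w.map (condExp τ (e l))).prod - w.prod)) atTop (𝓝 0) := by
  induction w with
  | nil => simp [sqNorm]
  | cons a w ih =>
    have h := ((ih.const_mul (‖(a : K →L[ℂ] K)‖ ^ 2)).const_mul 2).add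
      ((he (a * w.prod)).const_mul 2)
    simp only [mul_zero, add_zero] at h
    refine squeeze_zero (fun l => sqNorm_nonneg τ _) (fun l => ?_) h
    rw [List.map_cons, List.prod_cons, List.prod_cons, ← condExp_mul_right]
    set v := e l (w.map (condExp τ (e l))).prod
    refine (sqNorm_sub_le τ _ (e l (condExp τ (e l) (a * w.prod))) _).trans ?_
    rw [sqNorm_sub_comm τ _ (a * w.prod), ← map_sub, ← condExp_sub, ← mul_sub]
    gcongr
    exact (sqNorm_condExp_le τ (e l) _).trans (sqNorm_mul_le τ _ _)

theorem tendsto_normTrace_prod_condExp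
    (he : ∀ a, Tendsto (fun l => sqNorm τ (a - e l (condExp τ (e l) a))) atTop (𝓝 0))
    (w : List R.toStarSubalgebra) :
    Tendsto (fun l => normTrace (w.map (condExp τ (e l))).prod) atTop (𝓝 (τ.tr w.prod)) := by
  refine (tendsto_tr_of_tendsto_sqNorm τ (tendsto_sqNorm_prod_condExp τ he w)).congr fun l => ?_
  rw [tr_starAlgHom]

variable {H : Type*} [NormedAddCommGroup H] [InnerProductSpace ℂ H] [CompleteSpace H]
variable {M : VonNeumannAlgebra H} (φ : FaithfulNormalTrace M)

/-- The analogue of `microstates` in `R`: the tuples of selfadjoint elements of `R` whose moments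
of order at most `m` are `γ`-close to those of `x`. -/
def microstatesIn {n : ℕ} (x : Fin n → M.toStarSubalgebra) (m : ℕ) (γ : ℝ) :
    Set (Fin n → R.toStarSubalgebra) :=
  {f | (∀ i, IsSelfAdjoint (f i)) ∧ ∀ p : ℕ, 1 ≤ p → p ≤ m → ∀ i : Fin p → Fin n,
    ‖τ.tr (List.ofFn fun l => f (i l)).prod - φ.tr (List.ofFn fun l => x (i l)).prod‖ < γ}

/-- Conditional expectations turn the approximate microstates in `R` into matrix microstates. -/
theorem eventually_condExp_mem_microstates
    (he : ∀ a, Tendsto (fun l => sqNorm τ (a - e l (condExp τ (e l) a))) atTop (𝓝 0))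
    {n : ℕ} {x : Fin n → M.toStarSubalgebra} {m : ℕ} {γ : ℝ} {f : Fin n → R.toStarSubalgebra}
    (hf : f ∈ microstatesIn τ φ x m γ) :
    ∀ᶠ l in atTop, (fun i => condExp τ (e l) (f i)) ∈ microstates φ x m (k l) γ := by
  have h : ∀ᶠ l in atTop, ∀ p ∈ Set.Icc 1 m, ∀ i : Fin p → Fin n,
      ‖normTrace (List.ofFn fun j => condExp τ (e l) (f (i j))).prod -
        φ.tr (List.ofFn fun j => x (i j)).prod‖ < γ := by
    refine (eventually_all_finite (Set.finite_Icc 1 m)).2 fun p hp => eventually_all.2 fun i => ?_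
    have ht := ((tendsto_normTrace_prod_condExp τ he (List.ofFn fun j => f (i j))).sub_const
      (φ.tr (List.ofFn fun j => x (i j)).prod)).norm
    simp only [List.map_ofFn] at ht
    exact ht.eventually_lt_const (hf.2 p hp.1 hp.2 i)
  filter_upwards [h] with l hl
  exact ⟨fun i => isHermitian_condExp τ (e l) (hf.1 i), fun p h1 h2 i => hl p ⟨h1, h2⟩ i⟩

/-- Each entry of a tuple of selfadjoint matrices has a trace norm bounded by `tupleNorm`. -/
theorem sqNorm_lt_of_tupleNorm_lt {k n : ℕ}
    (e : Matrix (Fin k) (Fin k) ℂ →⋆ₐ[ℂ] R.toStarSubalgebra)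
    {ξ : Fin n → Matrix (Fin k) (Fin k) ℂ} (hξ : ∀ i, (ξ i).IsHermitian) {δ : ℝ}
    (h : tupleNorm ξ < Real.sqrt δ) (i : Fin n) : sqNorm τ (e (ξ i)) < δ := by
  have hs : ∀ i, (normTrace (ξ i ^ 2)).re = sqNorm τ (e (ξ i)) := by
    intro i
    have hi : star (ξ i) = ξ i := hξ i
    unfold sqNorm
    rw [← map_star, hi, ← map_mul, tr_starAlgHom, sq]
  unfold tupleNorm at h
  rw [Real.sqrt_lt_sqrt_iff (Finset.sum_nonneg fun i _ => (hs i).symm ▸ sqNorm_nonneg τ _)] at h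
  simp only [hs] at h
  exact (Finset.single_le_sum (f := fun i => sqNorm τ (e (ξ i)))
    (fun i _ => sqNorm_nonneg τ _) (Finset.mem_univ i)).trans_lt h

/-- Tubularity passes from matrices to the hyperfinite factor: tuples in `R` whose moments are
close to those of a tubular tuple are approximately unitarily conjugate. -/
theorem exists_unitary_conj_of_isTubular (hR : IsHyperfiniteIIOneFactor R τ)
    {n : ℕ} {x : Fin n → M.toStarSubalgebra} (hX : IsTubular φ x) {ε : ℝ} (hε : 0 < ε) :
    ∃ m : ℕ, ∃ γ : ℝ, 0 < γ ∧ ∀ f ∈ microstatesIn τ φ x m γ, ∀ g ∈ microstatesIn τ φ x m γ,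
      ∃ u ∈ unitary R.toStarSubalgebra, ∀ i, sqNorm τ (u * g i * star u - f i) < ε := by
  -- Two triangle inequalities for the squared norm cost at most `2 + 4 + 4 ≤ 16` times `ε / 16`.
  have hε16 : 0 < ε / 16 := by positivity
  obtain ⟨k, e, he⟩ := exists_tendsto_condExp τ hR
  obtain ⟨m, γ, hγ, hmain⟩ := hX _ (Real.sqrt_pos.2 hε16)
  refine ⟨m, γ, hγ, fun f hf g hg => ?_⟩
  have hclose : ∀ f : Fin n → R.toStarSubalgebra, ∀ᶠ l in atTop, ∀ i,
      sqNorm τ (f i - e l (condExp τ (e l) (f i))) < ε / 16 := fun f =>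
    eventually_all.2 fun i => (he (f i)).eventually_lt_const hε16
  obtain ⟨l, hlf, hlg, hcf, hcg⟩ := ((eventually_condExp_mem_microstates τ φ he hf).and
    ((eventually_condExp_mem_microstates τ φ he hg).and ((hclose f).and (hclose g)))).exists
  obtain ⟨u, hu, i, j, hij, hlt⟩ := hmain (k l)
    ![fun i => condExp τ (e l) (g i), fun i => condExp τ (e l) (f i)]
    (by intro i; fin_cases i <;> assumption)
  have h01 : ∀ i j : Fin 2, i < j → i = 0 ∧ j = 1 := by decide
  obtain ⟨rfl, rfl⟩ := h01 i j hij
  refine ⟨e l u, unitary_starAlgHom (e l) hu, fun i => ?_⟩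
  have h2 := sqNorm_lt_of_tupleNorm_lt τ (e l) (fun i => ?_) hlt i
  · simp only [Matrix.cons_val_zero, Matrix.cons_val_one, map_sub, map_mul, map_star] at h2
    have h1 := hcg i
    rw [← sqNorm_unitary_conj τ (unitary_starAlgHom (e l) hu), mul_sub, sub_mul] at h1
    have h3 := hcf i
    rw [sqNorm_sub_comm] at h3
    have h4 := sqNorm_sub_le τ (e l u * g i * star (e l u))
      (e l u * e l (condExp τ (e l) (g i)) * star (e l u)) (f i)
    have h5 := sqNorm_sub_le τ (e l u * e l (condExp τ (e l) (g i)) * star (e l u))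
      (e l (condExp τ (e l) (f i))) (f i)
    linarith
  · have h1 := Matrix.isHermitian_conjTranspose_mul_mul (star u) (hlg.1 i)
    rw [Matrix.star_eq_conjTranspose, Matrix.conjTranspose_conjTranspose] at h1
    exact h1.sub (hlf.1 i)

end Hyperfinite

/-! ### Conjugacy in the ultrapower -/

section Conjugacy

open Filter Topology

variable {K : Type*} [NormedAddCommGroup K] [InnerProductSpace ℂ K] [CompleteSpace K]
variable {R : VonNeumannAlgebra K} (τ : FaithfulNormalTrace R) (ω : Ultrafilter ℕ)

theorem tendsto_sqNorm_ultraTrace (f : boundedSeq R) :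
    Tendsto (fun j => sqNorm τ (f.1 j)) ω
      (𝓝 (ultraTrace τ ω (star (Q τ ω f) * Q τ ω f)).re) := by
  have h : star (Q τ ω f) * Q τ ω f = Q τ ω (star f * f) := ((Q τ ω).map_mul _ _).symm
  rw [h, ultraTrace_Q]
  exact (Complex.continuous_re.tendsto _).comp (tendsto_seqTrace τ ω (star f * f))

/-- The trace of `R^ω` is faithful. -/
theorem eq_zero_of_ultraTrace_eq_zero {a : Ultrapower τ ω}
    (h : (ultraTrace τ ω (star a * a)).re = 0) : a = 0 := by
  obtain ⟨f, rfl⟩ := Q_surjective τ ω a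
  have h1 := tendsto_sqNorm_ultraTrace τ ω f
  rw [h] at h1
  rw [← map_zero (Q τ ω), Q_eq_iff, sub_zero]
  exact h1

theorem ultraTrace_mul_comm (a b : Ultrapower τ ω) :
    ultraTrace τ ω (a * b) = ultraTrace τ ω (b * a) := by
  obtain ⟨f, rfl⟩ := Q_surjective τ ω a
  obtain ⟨g, rfl⟩ := Q_surjective τ ω b
  rw [← (Q τ ω).map_mul, ← (Q τ ω).map_mul, ultraTrace_Q, ultraTrace_Q]
  exact tendsto_nhds_unique (tendsto_seqTrace τ ω (f * g))
    ((tendsto_seqTrace τ ω (g * f)).congr fun j => τ.tr_mul_comm _ _)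

theorem ultraTrace_star_mul_self_nonneg (a : Ultrapower τ ω) :
    0 ≤ (ultraTrace τ ω (star a * a)).re := by
  obtain ⟨f, rfl⟩ := Q_surjective τ ω a
  exact ge_of_tendsto' (tendsto_sqNorm_ultraTrace τ ω f) fun j => sqNorm_nonneg τ _

theorem ultraTrace_sub_le (a b : Ultrapower τ ω) :
    (ultraTrace τ ω (star (a - b) * (a - b))).re ≤
      2 * (ultraTrace τ ω (star a * a)).re + 2 * (ultraTrace τ ω (star b * b)).re := by
  obtain ⟨f, rfl⟩ := Q_surjective τ ω a
  obtain ⟨g, rfl⟩ := Q_surjective τ ω b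
  rw [← (Q τ ω).map_sub]
  refine le_of_tendsto_of_tendsto' (tendsto_sqNorm_ultraTrace τ ω (f - g))
    (((tendsto_sqNorm_ultraTrace τ ω f).const_mul 2).add
      ((tendsto_sqNorm_ultraTrace τ ω g).const_mul 2)) fun j => ?_
  have h := sqNorm_sub_le τ (f.1 j) 0 (g.1 j)
  rwa [sqNorm_sub_comm τ 0, sub_zero, sub_zero] at h

theorem ultraTrace_unitary_conj (a : Ultrapower τ ω) {u : Ultrapower τ ω}
    (hu : u ∈ unitary (Ultrapower τ ω)) :
    ultraTrace τ ω (star (u * a * star u) * (u * a * star u)) = ultraTrace τ ω (star a * a) := by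
  have h1 : star u * u = 1 := (Unitary.mem_iff.1 hu).1
  have e : star (u * a * star u) * (u * a * star u) = u * (star a * a * star u) := by
    simp only [star_mul, star_star]
    calc u * (star a * star u) * (u * a * star u) = u * star a * (star u * u) * a * star u := by
          noncomm_ring
      _ = _ := by rw [h1]; noncomm_ring
  rw [e, ultraTrace_mul_comm, mul_assoc, h1, mul_one]

theorem Q_conj (v g : boundedSeq R) :
    Q τ ω v * Q τ ω g * star (Q τ ω v) = Q τ ω (v * g * star v) :=
  ((congrArg (· * Q τ ω (star v)) ((Q τ ω).map_mul v g)).symm).trans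
    ((Q τ ω).map_mul (v * g) (star v)).symm

theorem exists_selfAdjoint_lift {a : Ultrapower τ ω} (ha : IsSelfAdjoint a) :
    ∃ f : boundedSeq R, IsSelfAdjoint f ∧ Q τ ω f = a := by
  obtain ⟨f, rfl⟩ := Q_surjective τ ω a
  have h2 : algebraMap ℂ (boundedSeq R) 2⁻¹ * (f + f) = f := by
    rw [← two_smul ℂ f, ← Algebra.smul_def, smul_smul]
    norm_num
  refine ⟨algebraMap ℂ (boundedSeq R) 2⁻¹ * (f + star f), ?_, ?_⟩
  · rw [← Algebra.smul_def, IsSelfAdjoint, star_smul, star_add, star_star, add_comm]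
    simp
  · have h3 : Q τ ω (f + star f) = Q τ ω (f + f) := ((Q τ ω).map_add f (star f)).trans
      ((congrArg (Q τ ω f + ·) ha.star_eq).trans ((Q τ ω).map_add f f).symm)
    exact ((Q τ ω).map_mul _ _).trans ((congrArg (Q τ ω (algebraMap ℂ _ 2⁻¹) * ·) h3).trans
      (((Q τ ω).map_mul _ _).symm.trans (congrArg (Q τ ω) h2)))

theorem tendsto_tr_prod {n : ℕ} (f : Fin n → boundedSeq R) {p : ℕ} (i : Fin p → Fin n) :
    Tendsto (fun j => τ.tr (List.ofFn fun l => (f (i l)).1 j).prod) ω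
      (𝓝 (ultraTrace τ ω (List.ofFn fun l => Q τ ω (f (i l))).prod)) := by
  have h : (List.ofFn fun l => Q τ ω (f (i l))).prod =
      Q τ ω (List.ofFn fun l => f (i l)).prod := by
    rw [map_list_prod, List.map_ofFn]; rfl
  rw [h, ultraTrace_Q]
  refine (tendsto_seqTrace τ ω _).congr fun j => ?_
  let ev : boundedSeq R →* R.toStarSubalgebra :=
    { toFun := fun f => f.1 j, map_one' := rfl, map_mul' := fun _ _ => rfl }
  change τ.tr (ev _) = _
  rw [map_list_prod, List.map_ofFn]
  rfl

variable {H : Type*} [NormedAddCommGroup H] [InnerProductSpace ℂ H] [CompleteSpace H]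
variable {M : VonNeumannAlgebra H} (φ : FaithfulNormalTrace M)

/-- Representing sequences of the image of `x` under a trace preserving homomorphism are microstates
along `ω`. -/
theorem eventually_mem_microstatesIn {n : ℕ} {x : Fin n → M.toStarSubalgebra}
    {π : M.toStarSubalgebra →⋆ₐ[ℂ] Ultrapower τ ω} (hπ : ∀ a, ultraTrace τ ω (π a) = φ.tr a)
    {f : Fin n → boundedSeq R} (hf : ∀ i, IsSelfAdjoint (f i)) (hfπ : ∀ i, Q τ ω (f i) = π (x i))
    (m : ℕ) {γ : ℝ} (hγ : 0 < γ) :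
    ∀ᶠ j in (ω : Filter ℕ), (fun i => (f i).1 j) ∈ microstatesIn τ φ x m γ := by
  have h : ∀ᶠ j in (ω : Filter ℕ), ∀ p ∈ Set.Icc 1 m, ∀ i : Fin p → Fin n,
      ‖τ.tr (List.ofFn fun l => (f (i l)).1 j).prod -
        φ.tr (List.ofFn fun l => x (i l)).prod‖ < γ := by
    refine (eventually_all_finite (Set.finite_Icc 1 m)).2 fun p _ => eventually_all.2 fun i => ?_
    have ht := tendsto_tr_prod τ ω f i
    have e : (List.ofFn fun l => Q τ ω (f (i l))).prod = π (List.ofFn fun l => x (i l)).prod := by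
      rw [map_list_prod, List.map_ofFn]
      exact congrArg (fun F => (List.ofFn F).prod) (funext fun l => hfπ (i l))
    rw [e, hπ] at ht
    have := (ht.sub_const (φ.tr (List.ofFn fun l => x (i l)).prod)).norm
    rw [sub_self, norm_zero] at this
    exact this.eventually_lt_const hγ
  filter_upwards [h] with j hj
  exact ⟨fun i => congrArg (fun F : boundedSeq R => F.1 j) (hf i), fun p h1 h2 i => hj p ⟨h1, h2⟩ i⟩

/-- A diagonal choice: if for every `ε > 0` the constraint `P ε` can be met along `ω`, and `P` is
monotone, then one sequence meets all the constraints along `ω`. -/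
theorem exists_seq_eventually {α : Type*} [Nonempty α] (hω : ∀ i : ℕ, ω ≠ pure i)
    {P : ℝ → ℕ → α → Prop} (hmono : ∀ ε δ j a, ε ≤ δ → P ε j a → P δ j a)
    (h : ∀ ε, 0 < ε → ∀ᶠ j in (ω : Filter ℕ), ∃ a, P ε j a) :
    ∃ s : ℕ → α, ∀ ε, 0 < ε → ∀ᶠ j in (ω : Filter ℕ), P ε j (s j) := by
  classical
  have hat : (ω : Filter ℕ) ≤ atTop := by
    rw [← Nat.cofinite_eq_atTop]
    exact ω.le_cofinite_or_eq_pure.resolve_right fun ⟨i, hi⟩ => hω i hi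
  -- At stage `j` the best among the tolerances `1 / (N + 1)`, `N ≤ j`, is used.
  have hs : ∀ j : ℕ, ∃ a : α, ∀ N : ℕ, N ≤ j → (∃ b, P (1 / ((N : ℝ) + 1)) j b) →
      P (1 / ((N : ℝ) + 1)) j a := by
    intro j
    let N₀ : ℕ := Nat.findGreatest (fun N => ∃ b, P (1 / ((N : ℝ) + 1)) j b) j
    by_cases h0 : ∃ b, P (1 / ((N₀ : ℝ) + 1)) j b
    · obtain ⟨a, ha⟩ := h0
      refine ⟨a, fun N hN hb => hmono _ _ _ _ ?_ ha⟩
      exact one_div_le_one_div_of_le (by positivity)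
        (by gcongr; exact Nat.le_findGreatest hN hb)
    · refine ⟨Classical.arbitrary α, fun N hN hb => (h0 ?_).elim⟩
      exact Nat.findGreatest_spec (P := fun N => ∃ b, P (1 / ((N : ℝ) + 1)) j b) hN hb
  choose s hs using hs
  refine ⟨s, fun ε hε => ?_⟩
  obtain ⟨N, hN⟩ := exists_nat_one_div_lt hε
  filter_upwards [h _ (Nat.one_div_pos_of_nat (n := N)), hat (eventually_ge_atTop N)] with j h1 h2
  exact hmono _ _ _ _ hN.le (hs j N h2 h1)

/-- Two trace preserving homomorphisms into `R^ω` are unitarily conjugate on a tubular tuple: the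
unitary is represented by a sequence of unitaries of `R` which conjugate the coordinates of
selfadjoint representing sequences better and better along `ω`. -/
theorem exists_unitary_conj_generators (hR : IsHyperfiniteIIOneFactor R τ)
    (hω : ∀ i : ℕ, ω ≠ pure i) {n : ℕ} {x : Fin n → M.toStarSubalgebra}
    (hx : ∀ i, IsSelfAdjoint (x i)) (hX : IsTubular φ x)
    {σ π : M.toStarSubalgebra →⋆ₐ[ℂ] Ultrapower τ ω}
    (hσ : ∀ a, ultraTrace τ ω (σ a) = φ.tr a) (hπ : ∀ a, ultraTrace τ ω (π a) = φ.tr a) :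
    ∃ u ∈ unitary (Ultrapower τ ω), ∀ i, σ (x i) = u * π (x i) * star u := by
  choose f hf hfσ using fun i => exists_selfAdjoint_lift τ ω ((hx i).map σ)
  choose g hg hgπ using fun i => exists_selfAdjoint_lift τ ω ((hx i).map π)
  obtain ⟨s, hs⟩ := exists_seq_eventually ω hω
    (P := fun ε j (u : unitary R.toStarSubalgebra) =>
      ∀ i, sqNorm τ ((u : R.toStarSubalgebra) * (g i).1 j * star (u : R.toStarSubalgebra) -
        (f i).1 j) < ε)
    (fun ε δ j u hεδ h i => (h i).trans_le hεδ) (by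
      intro ε hε
      obtain ⟨m, γ, hγ, h⟩ := exists_unitary_conj_of_isTubular τ φ hR hX hε
      filter_upwards [eventually_mem_microstatesIn τ ω φ hσ hf hfσ m hγ,
        eventually_mem_microstatesIn τ ω φ hπ hg hgπ m hγ] with j h1 h2
      obtain ⟨u, hu, h3⟩ := h _ h1 _ h2
      exact ⟨⟨u, hu⟩, h3⟩)
  let v : boundedSeq R := ⟨fun j => (s j : R.toStarSubalgebra), ‖(1 : K →L[ℂ] K)‖, fun j => by
    have h := Unitary.mem_iff.1 (s j).2
    have h' : ((s j : R.toStarSubalgebra) : K →L[ℂ] K) ∈ unitary (K →L[ℂ] K) :=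
      Unitary.mem_iff.2 ⟨congrArg Subtype.val h.1, congrArg Subtype.val h.2⟩
    have h1 := CStarRing.norm_mem_unitary_mul (1 : K →L[ℂ] K) h'
    rw [mul_one] at h1
    exact h1.le⟩
  have hv : v ∈ unitary (boundedSeq R) := by
    rw [Unitary.mem_iff]
    exact ⟨Subtype.ext (funext fun j => (Unitary.mem_iff.1 (s j).2).1),
      Subtype.ext (funext fun j => (Unitary.mem_iff.1 (s j).2).2)⟩
  refine ⟨Q τ ω v, ?_, fun i => ?_⟩
  · rw [Unitary.mem_iff] at hv ⊢
    exact ⟨((Q τ ω).map_mul (star v) v).symm.trans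
        ((congrArg (Q τ ω) hv.1).trans (Q τ ω).map_one),
      ((Q τ ω).map_mul v (star v)).symm.trans ((congrArg (Q τ ω) hv.2).trans (Q τ ω).map_one)⟩
  · rw [← hfσ, ← hgπ, Q_conj, eq_comm, Q_eq_iff, mem_nullIdeal, tendsto_order]
    refine ⟨fun c hc => Eventually.of_forall fun j => hc.trans_le (sqNorm_nonneg τ _),
      fun ε hε => ?_⟩
    filter_upwards [hs ε hε] with j hj
    exact hj i

/-- Trace preserving `*`-homomorphisms which are conjugate on generators are conjugate: both sides
are continuous for the trace norm, in which the `*`-algebra of the generators is dense. -/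
theorem conj_of_conj_generators {n : ℕ} {x : Fin n → M.toStarSubalgebra}
    (hx : IsSelfAdjointGenerating M x)
    {σ π : M.toStarSubalgebra →⋆ₐ[ℂ] Ultrapower τ ω}
    (hσ : ∀ a, ultraTrace τ ω (σ a) = φ.tr a) (hπ : ∀ a, ultraTrace τ ω (π a) = φ.tr a)
    {u : Ultrapower τ ω} (hu : u ∈ unitary (Ultrapower τ ω))
    (hux : ∀ i, σ (x i) = u * π (x i) * star u) (a : M.toStarSubalgebra) :
    σ a = u * π a * star u := by
  have hu1 : star u * u = 1 := (Unitary.mem_iff.1 hu).1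
  have hu2 : u * star u = 1 := (Unitary.mem_iff.1 hu).2
  let B₀ : StarSubalgebra ℂ M.toStarSubalgebra := StarAlgebra.adjoin ℂ (Set.range x)
  have hB₀ : ∀ b ∈ B₀, σ b = u * π b * star u := by
    intro b hb
    induction hb using StarAlgebra.adjoin_induction with
    | mem y hy => obtain ⟨i, rfl⟩ := hy; exact hux i
    | algebraMap c =>
      rw [AlgHomClass.commutes, AlgHomClass.commutes, ← Algebra.commutes, mul_assoc, hu2, mul_one]
    | add y z _ _ hy hz => rw [map_add, map_add, hy, hz, mul_add, add_mul]
    | mul y z _ _ hy hz =>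
      rw [map_mul, map_mul, hy, hz]
      calc u * π y * star u * (u * π z * star u) = u * π y * (star u * u) * π z * star u := by
            noncomm_ring
        _ = _ := by rw [hu1]; noncomm_ring
    | star y _ hy => rw [map_star, map_star, hy, star_mul, star_mul, star_star, mul_assoc]
  let B : StarSubalgebra ℂ (H →L[ℂ] H) := B₀.map M.toStarSubalgebra.subtype
  have hB : Set.centralizer (Set.centralizer (B : Set (H →L[ℂ] H))) = (M : Set (H →L[ℂ] H)) := by
    refine subset_antisymm ?_ ?_
    · have : (B : Set (H →L[ℂ] H)) ⊆ M := by
        rintro _ ⟨b, -, rfl⟩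
        exact b.2
      have h := Set.centralizer_subset (Set.centralizer_subset this)
      rwa [M.centralizer_centralizer] at h
    · rw [← hx.2]
      refine Set.centralizer_subset (Set.centralizer_subset ?_)
      rintro _ ⟨i, rfl⟩
      exact ⟨x i, StarAlgebra.subset_adjoin ℂ _ ⟨i, rfl⟩, rfl⟩
  have hnorm : ∀ {ρ : M.toStarSubalgebra →⋆ₐ[ℂ] Ultrapower τ ω},
      (∀ a, ultraTrace τ ω (ρ a) = φ.tr a) → ∀ c,
      (ultraTrace τ ω (star (ρ c) * ρ c)).re = sqNorm φ c := by
    intro ρ hρ c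
    rw [← map_star, ← map_mul, hρ]
    rfl
  refine sub_eq_zero.1 (eq_zero_of_ultraTrace_eq_zero τ ω
    (le_antisymm (le_of_forall_pos_le_add fun ε hε => ?_)
      (ultraTrace_star_mul_self_nonneg τ ω _)))
  obtain ⟨b, ⟨b', hb', hbb'⟩, hlt⟩ := exists_sqNorm_sub_lt φ B hB a (ε := ε / 4) (by positivity)
  obtain rfl : b' = b := Subtype.ext hbb'
  -- The two homomorphisms agree on `b'`, so only `a - b'`, of small trace norm, is left.
  have e : σ a - u * π a * star u = σ (a - b') - u * π (a - b') * star u := by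
    rw [map_sub, map_sub, hB₀ b' hb', mul_sub, sub_mul]
    abel
  have h := ultraTrace_sub_le τ ω (σ (a - b')) (u * π (a - b') * star u)
  rw [ultraTrace_unitary_conj τ ω _ hu, hnorm hσ, hnorm hπ] at h
  rw [e]
  linarith

end Conjugacy

end Tubular

theorem lemma2p4 {H : Type*} [NormedAddCommGroup H] [InnerProductSpace ℂ H] [CompleteSpace H]
    {K : Type*} [NormedAddCommGroup K] [InnerProductSpace ℂ K] [CompleteSpace K]
    (R : VonNeumannAlgebra K) (τ : Tubular.FaithfulNormalTrace R)
    (hR : Tubular.IsHyperfiniteIIOneFactor R τ)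
    (ω : Ultrafilter ℕ) (hω : ∀ i : ℕ, ω ≠ pure i)
    (M : VonNeumannAlgebra H) (φ : Tubular.FaithfulNormalTrace M)
    (n : ℕ) (x : Fin n → M.toStarSubalgebra) (hx : Tubular.IsSelfAdjointGenerating M x)
    (hX : Tubular.IsTubular φ x)
    (σ π : M.toStarSubalgebra →⋆ₐ[ℂ] Tubular.Ultrapower τ ω)
    (hσ : Tubular.IsTracialEmbedding φ τ ω σ) (hπ : Tubular.IsTracialEmbedding φ τ ω π) :
    ∃ u ∈ unitary (Tubular.Ultrapower τ ω), ∀ a, σ a = u * π a * star u := by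
  obtain ⟨u, hu, h⟩ :=
    Tubular.exists_unitary_conj_generators τ ω φ hR hω hx.1 hX hσ.2.2 hπ.2.2
  exact ⟨u, hu, Tubular.conj_of_conj_generators τ ω φ hx hσ.2.2 hπ.2.2 hu h⟩
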